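/- For $n\ge 1$ let $Q_n(8,4)$ and $Q'_n(8,4)$ be the Möbius and the cylinder octagonal-quadrilateral network with $n$ octagons and $n$ quadrilaterals. That is, both are simple graphs on the $8n$ vertices $1,\dots,4n,1',\dots,(4n)'$, and both contain the edges $\{i,i+1\}$ and $\{i',(i+1)'\}$ for $1\le i\le 4n-1$, and the edges $\{i,i'\}$ for $1\le i\le 4n$ with $i\equiv 0$ or $1\pmod 4$; in addition $Q_n(8,4)$ has the edges $\{4n,1'\}$ and $\{(4n)',1\}$, while $Q'_n(8,4)$ has the edges $\{4n,1\}$ and $\{(4n)',1'\}$. For a finite connected graph $G$ let $W(G)=\sum_{\{u,v\}} d(u,v)$ be its Wiener index and $Kf(G)=\sum_{\{u,v\}} r(u,v)$ its Kirchhoff index, where the sums run over all unordered pairs of distinct vertices, $d(u,v)$ is the graph distance, and $r(u,v)$ is the resistance distance, i.e. the potential difference between $u$ and $v$ when every edge is a unit resistor and a unit current enters at $u$ and leaves at $v$. Then $$\lim_{n\to\infty}\frac{W(Q_n(8,4))}{Kf(Q_n(8,4))}=3\qquad\text{and}\qquad \lim_{n\to\infty}\frac{W(Q'_n(8,4))}{Kf(Q'_n(8,4))}=3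 .$$ Equivalently, the Kirchhoff index is asymptotically one third of the Wiener index: $Kf(Q_n(8,4))\sim\frac13 W(Q_n(8,4))$ and $Kf(Q'_n(8,4))\sim\frac13 W(Q'_n(8,4))$ as $n\to\infty$. -/

import Mathlib

open Filter Topology Asymptotics

noncomputable section

namespace OctQuad

/-- The vertices: `4n` columns, numbered from `0` to `4n - 1`, and two rows.  The vertex `i` is
`(i - 1, false)` and the vertex `i'` is `(i - 1, true)`. -/
abbrev Vertex (n : ℕ) : Type := Fin (4 * n) × Bool

/-- The edges common to both networks (each in one orientation): the two horizontal paths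
`1 - 2 - ⋯ - 4n` and `1' - 2' - ⋯ - (4n)'`, and the vertical edges `i - i'` for
`i ≡ 1` and `i ≡ 0` modulo `4` (columns `0, 3, 4, 7, 8, …` when counted from `0`). Successive
vertical edges bound octagons and quadrilaterals alternately. -/
def StripRel {n : ℕ} (u v : Vertex n) : Prop :=
  ((u.1 : ℕ) + 1 = (v.1 : ℕ) ∧ u.2 = v.2) ∨
    (u.1 = v.1 ∧ u.2 ≠ v.2 ∧ ((u.1 : ℕ) % 4 = 0 ∨ (u.1 : ℕ) % 4 = 3))

/-- `u` lies in the last column and `v` in the first column. -/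
def LastFirst {n : ℕ} (u v : Vertex n) : Prop :=
  (u.1 : ℕ) + 1 = 4 * n ∧ (v.1 : ℕ) = 0

/-- The Möbius network `Q_n(8,4)`: the strip is closed up by the crossed edges
`4n - 1'` and `(4n)' - 1`. -/
def mobius (n : ℕ) : SimpleGraph (Vertex n) :=
  SimpleGraph.fromRel fun u v => StripRel u v ∨ (LastFirst u v ∧ u.2 ≠ v.2)

/-- The cylinder network `Q'_n(8,4)`: the strip is closed up by the parallel edges
`4n - 1` and `(4n)' - 1'`. -/
def cylinder (n : ℕ) : SimpleGraph (Vertex n) :=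
  SimpleGraph.fromRel fun u v => StripRel u v ∨ (LastFirst u v ∧ u.2 = v.2)

section Indices

variable {V : Type*} [Fintype V]

open scoped Classical in
/-- `φ` is an electric potential on `G`, each edge being a unit resistor, when one unit of current
enters at `i` and leaves at `j`: by Kirchhoff's and Ohm's laws, the net current out of every
vertex `v`, which is `∑_{w ∼ v} (φ v - φ w) = (L(G) φ) v`, is `1` at `i`, `-1` at `j` and `0`
elsewhere (identically `0` if `i = j`). -/
def IsPotential (G : SimpleGraph V) (i j : V) (φ : V → ℝ) : Prop :=
  ∀ v, ∑ w with G.Adj v w, (φ v - φ w) = (if v = i then 1 else 0) - (if v = j then 1 else 0)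

open scoped Classical in
/-- The resistance distance `r_{ij}`: the potential difference between `i` and `j` when a unit
current flows from `i` to `j`. In a connected graph a potential exists; by
`IsPotential.resistance_eq` any choice of it gives the same value. -/
def resistance (G : SimpleGraph V) (i j : V) : ℝ :=
  if h : ∃ φ, IsPotential G i j φ then h.choose i - h.choose j else 0

/-- The Wiener index `∑_{i<j} d_{ij}`, as half of the sum over ordered pairs. -/
def wiener (G : SimpleGraph V) : ℝ := (∑ i, ∑ j, (G.dist i j : ℝ)) / 2

/-- The Kirchhoff index `∑_{i<j} r_{ij}`, as half of the sum over ordered pairs. -/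
def kirchhoff (G : SimpleGraph V) : ℝ := (∑ i, ∑ j, resistance G i j) / 2

theorem IsPotential.sub_eq {G : SimpleGraph V} {i j : V} {φ ψ : V → ℝ}
    (hφ : IsPotential G i j φ) (hψ : IsPotential G i j ψ) : φ i - φ j = ψ i - ψ j := by
  classical
  have key : ∀ f g : V → ℝ, IsPotential G i j f →
      ∑ v, g v * ∑ w with G.Adj v w, (f v - f w) = g i - g j := by
    intro f g hf
    have h : ∀ v, ∑ w with G.Adj v w, (f v - f w)
        = (if v = i then 1 else 0) - (if v = j then 1 else 0) := by
      intro v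
      convert hf v
    simp [h, mul_sub, Finset.sum_sub_distrib]
  rw [← key ψ φ hψ, ← key φ ψ hφ]
  simp only [Finset.sum_filter, Finset.mul_sum]
  rw [← sub_eq_zero, ← Finset.sum_sub_distrib]
  simp only [← Finset.sum_sub_distrib]
  have anti : ∀ v w : V,
      (φ v * (if G.Adj v w then ψ v - ψ w else 0) - ψ v * (if G.Adj v w then φ v - φ w else 0))
      = -(φ w * (if G.Adj w v then ψ w - ψ v else 0)
          - ψ w * (if G.Adj w v then φ w - φ v else 0)) := by
    intro v w
    by_cases h : G.Adj v w
    · simp only [h, h.symm, if_true]; ring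
    · have h2 : ¬ G.Adj w v := fun h3 => h h3.symm
      simp [h, h2]
  have hT : ∑ v, ∑ w, (φ v * (if G.Adj v w then ψ v - ψ w else 0)
        - ψ v * (if G.Adj v w then φ v - φ w else 0))
      = -∑ v, ∑ w, (φ w * (if G.Adj w v then ψ w - ψ v else 0)
        - ψ w * (if G.Adj w v then φ w - φ v else 0)) := by
    simp only [← Finset.sum_neg_distrib]
    exact Finset.sum_congr rfl fun v _ => Finset.sum_congr rfl fun w _ => anti v w
  rw [Finset.sum_comm (f := fun v w => φ w * (if G.Adj w v then ψ w - ψ v else 0)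
        - ψ w * (if G.Adj w v then φ w - φ v else 0))] at hT
  linarith

/-- The resistance distance does not depend on the choice of the potential. -/
theorem IsPotential.resistance_eq {G : SimpleGraph V} {i j : V} {φ : V → ℝ}
    (hφ : IsPotential G i j φ) : resistance G i j = φ i - φ j := by
  have h : ∃ φ, IsPotential G i j φ := ⟨φ, hφ⟩
  rw [resistance, dif_pos h]
  exact h.choose_spec.sub_eq hφ

end Indices

end OctQuad

end

/-! Both networks are a cycle of `4 * n` columns, each of two vertices, and to leading order only
the column difference matters. A vertex can change rows in at most 3 steps, so graph distance
exceeds cycle distance by at most 3 (`cycleDist_le_dist`, `dist_le_cycleDist`). For resistance,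
split a potential by the row exchange. The symmetric part lives on the cycle with doubled edges and
gives exactly `k(4n - k)/(8n)` at column difference `k` (`potential_add_swap`). The antisymmetric
part is damped by the rungs, and an energy estimate bounds its contribution by a constant
(`potential_sub_swap`). Summing over the pairs gives `W = 32n³ + O(n²)` and `Kf = (32/3)n³ + O(n²)`,
whence the ratio 3. The closing twist never enters, so both networks are treated at once. -/

namespace OctQuad

/-! ### Laplacian, Dirichlet energy and existence of potentials. -/

section Laplacian

variable {V : Type*} [Fintype V]

open scoped Classical in
/-- The Laplacian of `G`, applied to a function on the vertices. -/
noncomputable def lap (G : SimpleGraph V) (f : V → ℝ) (v : V) : ℝ :=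
  ∑ w with G.Adj v w, (f v - f w)

open scoped Classical in
theorem sum_mul_lap (G : SimpleGraph V) (f g : V → ℝ) :
    ∑ v, f v * lap G g v
      = (∑ v, ∑ w, if G.Adj v w then (f v - f w) * (g v - g w) else 0) / 2 := by
  have h1 : ∑ v, f v * lap G g v = ∑ v, ∑ w, if G.Adj v w then f v * (g v - g w) else 0 := by
    simp only [lap, Finset.sum_filter, Finset.mul_sum, mul_ite, mul_zero]
  have h2 : ∑ v, f v * lap G g v = ∑ v, ∑ w, if G.Adj v w then f w * (g w - g v) else 0 := by
    rw [h1, Finset.sum_comm]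
    simp only [G.adj_comm]
  rw [eq_div_iff two_ne_zero, mul_two]
  nth_rw 1 [h1]
  rw [h2, ← Finset.sum_add_distrib]
  refine Finset.sum_congr rfl fun v _ => ?_
  rw [← Finset.sum_add_distrib]
  refine Finset.sum_congr rfl fun w _ => ?_
  split_ifs <;> ring

theorem sum_mul_lap_comm (G : SimpleGraph V) (f g : V → ℝ) :
    ∑ v, f v * lap G g v = ∑ v, g v * lap G f v := by
  classical
  simp only [sum_mul_lap, mul_comm]

/-- The Dirichlet energy dominates the squared difference along each edge. -/
theorem sq_sub_le_energy {G : SimpleGraph V} (f : V → ℝ) {a b : V} (h : G.Adj a b) :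
    (f a - f b) ^ 2 ≤ ∑ v, f v * lap G f v := by
  classical
  rw [sum_mul_lap, le_div_iff₀ two_pos]
  have hnn : ∀ v w, 0 ≤ if G.Adj v w then (f v - f w) * (f v - f w) else 0 := by
    intro v w
    split_ifs
    · exact mul_self_nonneg _
    · exact le_rfl
  have hrow : ∀ {v w : V}, G.Adj v w → (f v - f w) ^ 2
      ≤ ∑ w, if G.Adj v w then (f v - f w) * (f v - f w) else 0 := by
    intro v w hvw
    refine le_trans ?_ (Finset.single_le_sum (fun x _ => hnn v x) (Finset.mem_univ w))
    rw [if_pos hvw, sq]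
  -- The edge occurs in both orientations, which compensates the factor 1/2 in the energy.
  have hab : ∑ v ∈ {a, b}, (∑ w, if G.Adj v w then (f v - f w) * (f v - f w) else 0)
      ≤ ∑ v, ∑ w, if G.Adj v w then (f v - f w) * (f v - f w) else 0 :=
    Finset.sum_le_sum_of_subset_of_nonneg (Finset.subset_univ _)
      fun v _ _ => Finset.sum_nonneg fun w _ => hnn v w
  rw [Finset.sum_pair h.ne] at hab
  have := hrow h
  have := hrow h.symm
  nlinarith

theorem lap_sub (G : SimpleGraph V) (f g : V → ℝ) (v : V) :
    lap G (fun x => f x - g x) v = lap G f v - lap G g v := by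
  classical
  rw [lap, lap, lap, ← Finset.sum_sub_distrib]
  exact Finset.sum_congr rfl fun w _ => by ring

theorem lap_comp_equiv (G : SimpleGraph V) (e : G ≃g G) (f : V → ℝ) (v : V) :
    lap G (fun x => f (e x)) v = lap G f (e v) := by
  classical
  simp only [lap, Finset.sum_filter]
  rw [← Equiv.sum_comp e.toEquiv fun w => if G.Adj (e v) w then f (e v) - f w else 0]
  exact Finset.sum_congr rfl fun w _ => if_congr e.map_adj_iff.symm rfl rfl

theorem lap_eq_zero_imp {G : SimpleGraph V} (hG : G.Connected) {f : V → ℝ}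
    (hf : ∀ v, lap G f v = 0) (a b : V) : f a = f b := by
  have hadj : ∀ {v w}, G.Adj v w → f v = f w := by
    intro v w h
    have := sq_sub_le_energy f h
    simp only [hf, mul_zero, Finset.sum_const_zero] at this
    exact sub_eq_zero.1 (pow_eq_zero_iff two_ne_zero |>.1 (le_antisymm this (sq_nonneg _)))
  obtain ⟨p⟩ := hG.preconnected a b
  induction p with
  | nil => rfl
  | cons h _ ih => exact (hadj h).trans ih

theorem sum_lap (G : SimpleGraph V) (f : V → ℝ) : ∑ v, lap G f v = 0 := by
  have := sum_mul_lap_comm G (fun _ => 1) f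
  simpa [lap] using this

/-- Adding the total sum to the Laplacian makes it injective, hence surjective. Laplacian values sum
to zero, so a preimage of data with total zero itself has sum zero and the added term vanishes. -/
theorem exists_isPotential {G : SimpleGraph V} (hG : G.Connected) (i j : V) :
    ∃ φ, IsPotential G i j φ := by
  classical
  have := hG.nonempty
  let F : (V → ℝ) →ₗ[ℝ] (V → ℝ) :=
    { toFun := fun f v => lap G f v + ∑ w, f w
      map_add' := by
        intro f g
        ext v
        simp only [lap, Pi.add_apply, Finset.sum_add_distrib, add_sub_add_comm]
        ring
      map_smul' := by
        intro c f
        ext v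
        simp only [lap, Pi.smul_apply, smul_eq_mul, ← mul_sub, ← Finset.mul_sum, ← mul_add,
          RingHom.id_apply] }
  have hF : ∀ f v, F f v = lap G f v + ∑ w, f w := fun _ _ => rfl
  have hsum : ∀ f, ∑ v, F f v = Fintype.card V * ∑ w, f w := by
    intro f
    simp [hF, Finset.sum_add_distrib, sum_lap]
  have hcard : (Fintype.card V : ℝ) ≠ 0 := Nat.cast_ne_zero.2 Fintype.card_ne_zero
  have hinj : Function.Injective F := by
    rw [← LinearMap.ker_eq_bot, LinearMap.ker_eq_bot']
    intro f hf
    have h0 : ∑ w, f w = 0 := by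
      have := hsum f
      rw [hf] at this
      simpa [hcard] using this
    have hlap : ∀ v, lap G f v = 0 := by
      intro v
      have := hF f v
      rw [hf, h0] at this
      simpa using this.symm
    ext v
    have hc : ∑ w, f w = Fintype.card V * f v := by
      rw [Finset.sum_congr rfl fun w _ => lap_eq_zero_imp hG hlap w v]
      simp
    rw [h0] at hc
    simpa [hcard] using hc.symm
  obtain ⟨φ, hφ⟩ := LinearMap.injective_iff_surjective.1 hinj
    (fun v => (if v = i then 1 else 0) - (if v = j then 1 else 0))
  have h0 : ∑ w, φ w = 0 := by
    have := hsum φ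
    rw [hφ] at this
    simpa [hcard] using this
  refine ⟨φ, fun v => ?_⟩
  have := hF φ v
  rw [hφ, h0, add_zero] at this
  exact this.symm

end Laplacian

/-! ### The closed strip: local structure and walks. -/

section Strip

variable {n : ℕ}

/-- The exchange of the two rows. -/
def swap (v : Vertex n) : Vertex n := (v.1, !v.2)

theorem swap_swap (v : Vertex n) : swap (swap v) = v := by simp [swap]

theorem swap_injective : Function.Injective (swap : Vertex n → Vertex n) :=
  Function.LeftInverse.injective swap_swap

/-- The column of `v` carries a vertical edge. -/
def IsRung (v : Vertex n) : Prop := (v.1 : ℕ) % 4 = 0 ∨ (v.1 : ℕ) % 4 = 3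

variable [NeZero n]

/-- The next vertex along the strip; closing it up changes the row if `ε` is true. -/
def next (ε : Bool) (v : Vertex n) : Vertex n :=
  (v.1 + 1, if v.1 + 1 = 0 then xor v.2 ε else v.2)

/-- The preceding vertex along the strip. -/
def prev (ε : Bool) (v : Vertex n) : Vertex n :=
  (v.1 - 1, if v.1 = 0 then xor v.2 ε else v.2)

/-- `G` is the strip closed up to a cylinder (`ε = false`) or to a Möbius band (`ε = true`). -/
def IsClosedStrip (ε : Bool) (G : SimpleGraph (Vertex n)) : Prop :=
  ∀ v w, G.Adj v w ↔ w = next ε v ∨ w = prev ε v ∨ (w = swap v ∧ IsRung v)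

theorem one_le_of_neZero : 1 ≤ n := NeZero.one_le

theorem val_add_one (c : Fin (4 * n)) :
    ((c + 1 : Fin (4 * n)) : ℕ) = if (c : ℕ) + 1 = 4 * n then 0 else (c : ℕ) + 1 := by
  have hn : 1 ≤ n := one_le_of_neZero
  have h1 : ((1 : Fin (4 * n)) : ℕ) = 1 := by
    rw [Fin.val_one', Nat.mod_eq_of_lt (by omega)]
  rw [Fin.val_add, h1]
  split_ifs with h
  · rw [h, Nat.mod_self]
  · exact Nat.mod_eq_of_lt (by omega)

theorem val_sub_one (c : Fin (4 * n)) :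
    ((c - 1 : Fin (4 * n)) : ℕ) = if (c : ℕ) = 0 then 4 * n - 1 else (c : ℕ) - 1 := by
  have h := val_add_one (c - 1)
  rw [sub_add_cancel] at h
  split_ifs at h ⊢ <;> omega

theorem add_one_ne (c : Fin (4 * n)) : c + 1 ≠ c := by
  have hn : 1 ≤ n := one_le_of_neZero
  intro h
  have h' := val_add_one c
  rw [h] at h'
  split_ifs at h' <;> omega

theorem sub_one_ne (c : Fin (4 * n)) : c - 1 ≠ c := by
  intro h
  apply add_one_ne (c - 1)
  rw [sub_add_cancel, h]

theorem add_one_ne_sub_one (c : Fin (4 * n)) : c + 1 ≠ c - 1 := by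
  have hn : 1 ≤ n := one_le_of_neZero
  intro h
  have h1 := val_add_one c
  have h2 := val_sub_one c
  rw [h] at h1
  split_ifs at h1 h2 <;> omega

theorem next_prev (ε : Bool) (v : Vertex n) : next ε (prev ε v) = v := by
  obtain ⟨c, b⟩ := v
  by_cases h : c = 0 <;> simp [next, prev, h]

theorem prev_next (ε : Bool) (v : Vertex n) : prev ε (next ε v) = v := by
  obtain ⟨c, b⟩ := v
  by_cases h : c + 1 = 0
  · simp only [next, prev, h, if_true, Bool.xor_assoc, Bool.xor_self, Bool.xor_false]
    rw [← h, add_sub_cancel_right]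
  · simp [next, prev, h]

theorem next_eq_iff {ε : Bool} {v w : Vertex n} : v = next ε w ↔ w = prev ε v :=
  ⟨fun h => by rw [h, prev_next], fun h => by rw [h, next_prev]⟩

theorem next_swap (ε : Bool) (v : Vertex n) : next ε (swap v) = swap (next ε v) := by
  obtain ⟨c, b⟩ := v
  by_cases h : c + 1 = 0 <;> simp [next, swap, h]

theorem prev_swap (ε : Bool) (v : Vertex n) : prev ε (swap v) = swap (prev ε v) := by
  rw [eq_comm, ← next_eq_iff, next_swap, next_prev]

/-- `r` lists horizontal edges in one orientation; symmetrizing supplies `prev`, while the rung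
relation is its own converse. -/
theorem isClosedStrip_fromRel {ε : Bool} {r : Vertex n → Vertex n → Prop}
    (hr : ∀ u v, r u v ↔ v = next ε u ∨ (v = swap u ∧ IsRung u)) :
    IsClosedStrip ε (SimpleGraph.fromRel r) := by
  intro v w
  have h1 : ∀ v : Vertex n, v ≠ next ε v := fun v h => add_one_ne v.1 (congrArg Prod.fst h).symm
  have h2 : ∀ v : Vertex n, v ≠ swap v := fun v h => by simpa [swap] using congrArg Prod.snd h
  have h3 : v = swap w ∧ IsRung w ↔ w = swap v ∧ IsRung v := by
    constructor
    · rintro ⟨rfl, h⟩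
      exact ⟨(swap_swap w).symm, h⟩
    · rintro ⟨rfl, h⟩
      exact ⟨(swap_swap v).symm, h⟩
  rw [SimpleGraph.fromRel_adj, hr, hr, h3, ← next_eq_iff]
  constructor
  · tauto
  · intro h
    refine ⟨?_, by tauto⟩
    rintro rfl
    rcases h with h | h | h
    · exact h1 _ h
    · exact h1 _ h
    · exact h2 _ h.1

theorem stripRel_or_iff (ε : Bool) (u v : Vertex n) :
    (StripRel u v ∨ (LastFirst u v ∧ xor u.2 ε = v.2)) ↔
      v = next ε u ∨ (v = swap u ∧ IsRung u) := by
  have hn : 1 ≤ n := one_le_of_neZero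
  obtain ⟨c, b⟩ := u
  obtain ⟨d, b'⟩ := v
  have hc := val_add_one c
  have hd := d.2
  have hsw : b ≠ b' ↔ b' = !b := by cases b <;> cases b' <;> simp
  have hcd : c = d ↔ d = c := eq_comm
  simp only [StripRel, LastFirst, next, swap, IsRung, Prod.mk.injEq, hsw, hcd]
  by_cases h : (c : ℕ) + 1 = 4 * n
  · have h0 : c + 1 = 0 := Fin.ext (by rw [hc, if_pos h]; rfl)
    have hd0 : (d : ℕ) = 0 ↔ d = 0 := by rw [Fin.ext_iff]; rfl
    simp only [h0, if_true, h, hd0, true_and,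
      eq_comm (a := xor b ε)]
    have h4 : ¬ (4 * n = (d : ℕ)) := by omega
    simp only [h4, false_and, false_or]
    tauto
  · have h0 : c + 1 ≠ 0 := by
      intro h0
      rw [h0, if_neg h] at hc
      simp at hc
    have h5 : d = c + 1 ↔ (c : ℕ) + 1 = d := by
      rw [Fin.ext_iff, hc, if_neg h, eq_comm]
    simp only [h0, if_false, h, false_and, or_false, h5, eq_comm (a := b)]
    tauto

theorem isClosedStrip_mobius : IsClosedStrip true (mobius n) := by
  refine isClosedStrip_fromRel fun u v => ?_
  have h : (u.2 ≠ v.2) ↔ (xor u.2 true = v.2) := by cases u.2 <;> cases v.2 <;> simp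
  rw [← stripRel_or_iff, h]

theorem isClosedStrip_cylinder : IsClosedStrip false (cylinder n) := by
  refine isClosedStrip_fromRel fun u v => ?_
  rw [← stripRel_or_iff]
  simp

namespace IsClosedStrip

variable {ε : Bool} {G : SimpleGraph (Vertex n)}

theorem adj_next (hG : IsClosedStrip ε G) (v : Vertex n) : G.Adj v (next ε v) :=
  (hG _ _).2 (Or.inl rfl)

theorem adj_prev (hG : IsClosedStrip ε G) (v : Vertex n) : G.Adj v (prev ε v) :=
  (hG _ _).2 (Or.inr (Or.inl rfl))

theorem adj_swap (hG : IsClosedStrip ε G) {v : Vertex n} (hv : IsRung v) : G.Adj v (swap v) :=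
  (hG _ _).2 (Or.inr (Or.inr ⟨rfl, hv⟩))

theorem adj_swap_swap (hG : IsClosedStrip ε G) (v w : Vertex n) :
    G.Adj (swap v) (swap w) ↔ G.Adj v w := by
  rw [hG, hG, next_swap, prev_swap, swap_injective.eq_iff, swap_injective.eq_iff,
    swap_injective.eq_iff]
  rfl

/-- The exchange of the rows as an automorphism. -/
def swapIso (hG : IsClosedStrip ε G) : G ≃g G where
  toFun := swap
  invFun := swap
  left_inv := swap_swap
  right_inv := swap_swap
  map_rel_iff' := hG.adj_swap_swap _ _

theorem exists_isRung (hG : IsClosedStrip ε G) (v : Vertex n) :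
    ∃ u, IsRung u ∧ (u = v ∨ G.Adj v u) := by
  by_cases hv : IsRung v
  · exact ⟨v, hv, Or.inl rfl⟩
  · have hlt := v.1.2
    have h1 := val_add_one v.1
    have h2 := val_sub_one v.1
    have hv' : (v.1 : ℕ) % 4 = 1 ∨ (v.1 : ℕ) % 4 = 2 := by
      simp only [IsRung] at hv
      omega
    rcases hv' with hv' | hv'
    · refine ⟨prev ε v, Or.inl ?_, Or.inr (hG.adj_prev v)⟩
      rw [if_neg (by omega)] at h2
      simp only [prev, h2]
      omega
    · refine ⟨next ε v, Or.inr ?_, Or.inr (hG.adj_next v)⟩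
      rw [if_neg (by omega)] at h1
      simp only [next, h1]
      omega

open scoped Classical in
theorem sum_adj (hG : IsClosedStrip ε G) (v : Vertex n) (F : Vertex n → ℝ) :
    ∑ w with G.Adj v w, F w
      = F (next ε v) + F (prev ε v) + if IsRung v then F (swap v) else 0 := by
  have h1 : next ε v ≠ prev ε v := fun h => add_one_ne_sub_one v.1 (congrArg Prod.fst h)
  have h2 : next ε v ≠ swap v := fun h => add_one_ne v.1 (congrArg Prod.fst h)
  have h3 : prev ε v ≠ swap v := fun h => sub_one_ne v.1 (congrArg Prod.fst h)
  by_cases hv : IsRung v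
  · have : (Finset.univ.filter fun w => G.Adj v w) = {next ε v, prev ε v, swap v} := by
      ext w
      simp [hG v w, hv]
    rw [this, Finset.sum_insert (by simp [h1, h2]), Finset.sum_pair h3, if_pos hv, add_assoc]
  · have : (Finset.univ.filter fun w => G.Adj v w) = {next ε v, prev ε v} := by
      ext w
      simp [hG v w, hv]
    rw [this, Finset.sum_pair h1, if_neg hv, add_zero]

/-- A function of the column sees neither the rungs nor the twist, so only the cycle Laplacian
remains. -/
theorem lap_column (hG : IsClosedStrip ε G) (p : Fin (4 * n) → ℝ) (v : Vertex n) :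
    lap G (fun w => p w.1) v = 2 * p v.1 - p (v.1 + 1) - p (v.1 - 1) := by
  classical
  have := hG.sum_adj v (fun w => p v.1 - p w.1)
  simp only [next, prev, swap, sub_self, ite_self, add_zero] at this
  rw [lap]
  convert this using 1
  ring

/-- The walk to a prescribed column in the direction of increasing columns. -/
theorem exists_walk_column (hG : IsClosedStrip ε G) (u : Vertex n) (c : Fin (4 * n)) :
    ∃ b, ∃ p : G.Walk u (c, b), p.length = ((c - u.1 : Fin (4 * n)) : ℕ) := by
  generalize hk : ((c - u.1 : Fin (4 * n)) : ℕ) = k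
  induction k generalizing c with
  | zero =>
    have h0 : c - u.1 = 0 := Fin.ext hk
    obtain rfl : c = u.1 := sub_eq_zero.1 h0
    exact ⟨u.2, SimpleGraph.Walk.nil, rfl⟩
  | succ k ih =>
    have h1 := val_sub_one (c - u.1)
    rw [hk, if_neg (Nat.succ_ne_zero k), Nat.add_sub_cancel] at h1
    rw [sub_right_comm] at h1
    obtain ⟨b, p, hp⟩ := ih (c - 1) h1
    have hadj := hG.adj_next (c - 1, b)
    have hc : next ε (c - 1, b) = (c, (next ε (c - 1, b)).2) :=
      Prod.ext (sub_add_cancel c 1) rfl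
    rw [hc] at hadj
    exact ⟨_, p.concat hadj, by rw [SimpleGraph.Walk.length_concat, hp]⟩

/-- Step to an adjacent rung if necessary, cross it, and step back in the other row. -/
theorem exists_walk_swap (hG : IsClosedStrip ε G) (v : Vertex n) :
    ∃ p : G.Walk v (swap v), p.length ≤ 3 := by
  obtain ⟨u, hu, rfl | hvu⟩ := hG.exists_isRung v
  · exact ⟨(hG.adj_swap hu).toWalk, by simp⟩
  · refine ⟨.cons hvu (.cons (hG.adj_swap hu)
      (.cons ((hG.adj_swap_swap u v).2 hvu.symm) .nil)), by simp⟩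

theorem exists_walk (hG : IsClosedStrip ε G) (u v : Vertex n) :
    ∃ p : G.Walk u v, p.length ≤ ((v.1 - u.1 : Fin (4 * n)) : ℕ) + 3 := by
  obtain ⟨b, p, hp⟩ := hG.exists_walk_column u v.1
  by_cases hb : b = v.2
  · subst hb
    exact ⟨p, by omega⟩
  · have hv : (v.1, b) = swap v := Prod.ext rfl (Bool.eq_not.2 hb)
    rw [← hp]
    clear hp
    revert p
    rw [hv]
    intro p
    obtain ⟨q, hq⟩ := hG.exists_walk_swap v
    exact ⟨p.append q.reverse, by simpa using hq⟩

theorem connected (hG : IsClosedStrip ε G) : G.Connected :=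
  haveI : Nonempty (Vertex n) := ⟨(0, false)⟩
  ⟨fun u v => ⟨(hG.exists_walk u v).choose⟩⟩

end IsClosedStrip

/-! ### Graph distance against cycle distance. -/

/-- The distance of `c` from `0` in the cycle of length `4 * n`. -/
def cycleDist (c : Fin (4 * n)) : ℕ := min (c : ℕ) (4 * n - (c : ℕ))

theorem cycleDist_add_one_le (c : Fin (4 * n)) : cycleDist (c + 1) ≤ cycleDist c + 1 := by
  have := val_add_one c
  have := c.2
  simp only [cycleDist, min_def]
  split_ifs at * <;> omega

theorem cycleDist_sub_one_le (c : Fin (4 * n)) : cycleDist (c - 1) ≤ cycleDist c + 1 := by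
  have := val_sub_one c
  have := c.2
  simp only [cycleDist, min_def]
  split_ifs at * <;> omega

theorem val_sub_comm (c d : Fin (4 * n)) (h : c ≠ d) :
    ((c - d : Fin (4 * n)) : ℕ) = 4 * n - ((d - c : Fin (4 * n)) : ℕ) := by
  have h1 : (((c - d) + (d - c) : Fin (4 * n)) : ℕ) = 0 := by simp
  have hc : ((c - d : Fin (4 * n)) : ℕ) ≠ 0 := fun h0 => h (sub_eq_zero.1 (Fin.ext h0))
  have := (c - d).2
  have := (d - c).2
  rw [Fin.val_add] at h1
  obtain ⟨k, hk⟩ := Nat.dvd_of_mod_eq_zero h1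
  have : k < 2 := by
    by_contra! h2
    have : 4 * n * 2 ≤ 4 * n * k := Nat.mul_le_mul_left _ h2
    omega
  interval_cases k <;> omega

namespace IsClosedStrip

variable {ε : Bool} {G : SimpleGraph (Vertex n)}

/-- Cycle distance to a fixed column changes by at most 1 along an edge. -/
theorem cycleDist_le_dist (hG : IsClosedStrip ε G) (u v : Vertex n) :
    cycleDist (v.1 - u.1) ≤ G.dist u v := by
  obtain ⟨p, hp⟩ := hG.connected.exists_walk_length_eq_dist v u
  rw [SimpleGraph.dist_comm, ← hp]
  clear hp
  induction p with
  | nil => simp [cycleDist]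
  | @cons a b c h p ih =>
    rw [SimpleGraph.Walk.length_cons]
    rcases (hG _ _).1 h with rfl | rfl | ⟨rfl, -⟩
    · have := cycleDist_sub_one_le ((next ε a).1 - c.1)
      have h' : (next ε a).1 - c.1 - 1 = a.1 - c.1 := by
        simp only [next]
        abel
      rw [h'] at this
      omega
    · have := cycleDist_add_one_le ((prev ε a).1 - c.1)
      have h' : (prev ε a).1 - c.1 + 1 = a.1 - c.1 := by
        simp only [prev]
        abel
      rw [h'] at this
      omega
    · exact ih.trans (Nat.le_succ _)

/-- The increasing walks from `u` to `v` and from `v` to `u` go round the cycle in the two possible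
ways. -/
theorem dist_le_cycleDist (hG : IsClosedStrip ε G) (u v : Vertex n) :
    G.dist u v ≤ cycleDist (v.1 - u.1) + 3 := by
  obtain ⟨p, hp⟩ := hG.exists_walk u v
  obtain ⟨q, hq⟩ := hG.exists_walk v u
  have h1 := SimpleGraph.dist_le p
  have h2 := SimpleGraph.dist_le q
  rw [SimpleGraph.dist_comm] at h2
  simp only [cycleDist, min_def]
  by_cases h : u.1 = v.1
  · have h0 : ((v.1 - u.1 : Fin (4 * n)) : ℕ) = 0 := by rw [h, sub_self]; rfl
    split_ifs <;> omega
  · have := val_sub_comm u.1 v.1 h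
    split_ifs <;> omega

end IsClosedStrip

end Strip

/-! ### Resistance against the cycle resistance. -/

section Strip

theorem sum_mul_potential {V : Type*} [Fintype V] {G : SimpleGraph V} {i j : V} {φ : V → ℝ}
    (hφ : IsPotential G i j φ) (f : V → ℝ) : ∑ v, f v * lap G φ v = f i - f j := by
  classical
  have h : ∀ v, lap G φ v = (if v = i then 1 else 0) - (if v = j then 1 else 0) := by
    intro v
    rw [← hφ v, lap]
  simp [h, mul_sub, Finset.sum_sub_distrib]

variable {n : ℕ}

theorem sum_vertex (v : Vertex n) (f : Vertex n → ℝ) :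
    ∑ w : Vertex n, (f w * if w.1 = v.1 then 1 else 0) = f v + f (swap v) := by
  rw [Fintype.sum_prod_type, Finset.sum_eq_single v.1]
  · obtain ⟨c, b⟩ := v
    cases b <;> simp [swap, add_comm]
  · intro c _ hc
    simp [hc]
  · simp

theorem sum_cycleDist : ∑ c : Fin (4 * n), (cycleDist c : ℝ) = 4 * n ^ 2 := by
  -- The terms at `k` and `m + k` are `k` and `m - k`, with sum `m`.
  have h : ∀ m : ℕ, ∑ k ∈ Finset.range (m + m), min k (m + m - k) = m ^ 2 := by
    intro m
    rw [Finset.sum_range_add, ← Finset.sum_add_distrib, sq]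
    refine (Finset.sum_congr rfl fun k hk => ?_).trans (b := ∑ k ∈ Finset.range m, m) (by simp)
    rw [Finset.mem_range] at hk
    omega
  rw [← Nat.cast_sum]
  unfold cycleDist
  rw [Fin.sum_univ_eq_sum_range fun k => min k (4 * n - k)]
  have := h (2 * n)
  rw [show 2 * n + 2 * n = 4 * n by ring] at this
  rw [this]
  push_cast
  ring

variable [NeZero n]

/-- `4 * n` times the resistance distance of `c` from `0` in the cycle of length `4 * n` with
resistors `1 / 2`. -/
noncomputable def cyclePot (c : Fin (4 * n)) : ℝ := (c : ℕ) * (4 * n - (c : ℕ)) / 2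

theorem cyclePot_zero : cyclePot (0 : Fin (4 * n)) = 0 := by simp [cyclePot]

theorem cyclePot_sub_comm (c d : Fin (4 * n)) : cyclePot (c - d) = cyclePot (d - c) := by
  by_cases h : c = d
  · rw [h]
  · have h1 := (d - c).2
    have h2 : (((c - d : Fin (4 * n)) : ℕ) : ℝ) = 4 * n - ((d - c : Fin (4 * n)) : ℕ) := by
      rw [val_sub_comm c d h, Nat.cast_sub h1.le]
      push_cast
      ring
    simp only [cyclePot, h2]
    ring

/-- Up to scale this is a Green function of the cycle; the constant 1 cancels between two
translates. -/
theorem cyclePot_second_difference (c : Fin (4 * n)) :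
    2 * cyclePot c - cyclePot (c + 1) - cyclePot (c - 1) = 1 - if c = 0 then 4 * (n : ℝ) else 0 := by
  have hn : 1 ≤ n := one_le_of_neZero
  have hc := c.2
  have h0 : c = 0 ↔ (c : ℕ) = 0 := by rw [Fin.ext_iff]; rfl
  simp only [cyclePot, val_add_one, val_sub_one, h0]
  by_cases h1 : (c : ℕ) = 0
  · rw [if_neg (by omega), if_pos h1, if_pos h1, h1, Nat.cast_sub (by omega)]
    push_cast
    ring
  · by_cases h2 : (c : ℕ) + 1 = 4 * n
    · rw [if_pos h2, if_neg h1, if_neg h1, Nat.cast_sub (by omega)]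
      have h3 : (4 * n : ℝ) = (c : ℕ) + 1 := by exact_mod_cast h2.symm
      rw [h3]
      push_cast
      ring
    · rw [if_neg h2, if_neg h1, if_neg h1, Nat.cast_sub (by omega)]
      push_cast
      ring

namespace IsClosedStrip

variable {ε : Bool} {G : SimpleGraph (Vertex n)}

/-- The part of a potential that is symmetric under the exchange of the rows. -/
theorem potential_add_swap (hG : IsClosedStrip ε G) {i j : Vertex n} {φ : Vertex n → ℝ}
    (hφ : IsPotential G i j φ) :
    (φ i + φ (swap i)) - (φ j + φ (swap j)) = 2 * cyclePot (j.1 - i.1) / (4 * n) := by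
  have hn : (n : ℝ) ≠ 0 := NeZero.ne _
  -- The Laplacian of this test function is `4 * n` times the indicator of the column of `i` minus
  -- that of `j`; Green symmetry moves it onto `φ`.
  have h := sum_mul_potential hφ fun w => cyclePot (w.1 - j.1) - cyclePot (w.1 - i.1)
  rw [sum_mul_lap_comm] at h
  have hlap : ∀ w : Vertex n,
      φ w * lap G (fun w => cyclePot (w.1 - j.1) - cyclePot (w.1 - i.1)) w
        = (4 * n) * (φ w * if w.1 = i.1 then 1 else 0)
          - (4 * n) * (φ w * if w.1 = j.1 then 1 else 0) := by
    intro w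
    rw [lap_sub, hG.lap_column (fun c => cyclePot (c - j.1)),
      hG.lap_column (fun c => cyclePot (c - i.1))]
    have h1 := cyclePot_second_difference (w.1 - j.1)
    have h2 := cyclePot_second_difference (w.1 - i.1)
    simp only [sub_eq_zero] at h1 h2
    rw [sub_add_eq_add_sub, sub_right_comm w.1] at h1 h2
    rw [h1, h2]
    split_ifs <;> ring
  rw [Finset.sum_congr rfl fun w _ => hlap w, Finset.sum_sub_distrib, ← Finset.mul_sum,
    ← Finset.mul_sum, sum_vertex, sum_vertex, sub_self, sub_self, cyclePot_zero,
    cyclePot_sub_comm i.1] at h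
  rw [eq_div_iff (by simpa using hn)]
  linarith

/-- The part of a potential that is antisymmetric under the exchange of the rows is bounded. -/
theorem potential_sub_swap (hG : IsClosedStrip ε G) {i j : Vertex n} {φ : Vertex n → ℝ}
    (hφ : IsPotential G i j φ) :
    |(φ i - φ (swap i)) - (φ j - φ (swap j))| ≤ 18 := by
  set β : Vertex n → ℝ := fun v => φ v - φ (swap v) with hβ
  have hβs : ∀ v, β (swap v) = -β v := fun v => by simp [hβ, swap_swap]
  set E := ∑ v, β v * lap G β v with hE
  -- With `2|β| ≤ 3√E` everywhere, this identity gives `E ≤ 6√E`, so `√E ≤ 6` and `|β i - β j| = E /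
  -- 2 ≤ 18`.
  have hEβ : E = 2 * (β i - β j) := by
    have h1 : ∀ v, lap G β v = lap G φ v - lap G φ (swap v) := fun v => by
      rw [hβ, lap_sub]
      congr 1
      exact lap_comp_equiv G hG.swapIso φ v
    have h2 : ∑ v, β v * lap G φ (swap v) = ∑ v, β (swap v) * lap G φ v := by
      rw [← Equiv.sum_comp hG.swapIso.toEquiv]
      refine Finset.sum_congr rfl fun v _ => ?_
      change β (swap v) * lap G φ (swap (swap v)) = _
      rw [swap_swap]
    rw [hE]
    simp only [h1, mul_sub, Finset.sum_sub_distrib]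
    rw [h2, sum_mul_potential hφ, sum_mul_potential hφ, hβs, hβs]
    ring
  have hE0 : 0 ≤ E := (sq_nonneg _).trans (sq_sub_le_energy β (hG.adj_next i))
  have hedge : ∀ {v w}, G.Adj v w → |β v - β w| ≤ √E := fun h =>
    Real.abs_le_sqrt (sq_sub_le_energy β h)
  have hrung : ∀ v, IsRung v → 2 * |β v| ≤ √E := fun v hv => by
    -- Across a rung `β` changes sign, so the difference there is `2 * β v`.
    have := hedge (hG.adj_swap hv)
    rwa [hβs, sub_neg_eq_add, ← two_mul, abs_mul, abs_two] at this
  have hbound : ∀ v, 2 * |β v| ≤ 3 * √E := fun v => by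
    obtain ⟨u, hu, rfl | huv⟩ := hG.exists_isRung v
    · linarith [hrung u hu, Real.sqrt_nonneg E]
    · have := abs_sub_abs_le_abs_sub (β v) (β u)
      linarith [hrung u hu, hedge huv]
  have hE6 : √E ≤ 6 := by
    have h1 := hbound i
    have h2 := hbound j
    have h3 := abs_sub (β i) (β j)
    have h4 := le_abs_self (β i - β j)
    have h5 := Real.sq_sqrt hE0
    have h6 := Real.sqrt_nonneg E
    nlinarith
  change |β i - β j| ≤ 18
  have h5 := Real.sq_sqrt hE0
  have h6 := Real.sqrt_nonneg E
  rw [abs_of_nonneg (by linarith)]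
  nlinarith

theorem abs_resistance_sub_le (hG : IsClosedStrip ε G) (i j : Vertex n) :
    |resistance G i j - cyclePot (j.1 - i.1) / (4 * n)| ≤ 9 := by
  obtain ⟨φ, hφ⟩ := exists_isPotential hG.connected i j
  have h1 := hG.potential_add_swap hφ
  have h2 := abs_le.1 (hG.potential_sub_swap hφ)
  rw [mul_div_assoc] at h1
  rw [hφ.resistance_eq, abs_le]
  constructor <;> linarith [h2.1, h2.2]

end IsClosedStrip

/-! ### Summation over all pairs. -/

theorem sum_sum_column (F : Fin (4 * n) → ℝ) :
    ∑ u : Vertex n, ∑ v : Vertex n, F (v.1 - u.1) = 16 * n * ∑ c, F c := by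
  have h : ∀ u : Vertex n, ∑ v : Vertex n, F (v.1 - u.1) = 2 * ∑ c, F c := by
    intro u
    rw [Fintype.sum_prod_type]
    simp only [Finset.sum_const, Finset.card_univ, Fintype.card_bool, nsmul_eq_mul]
    rw [← Finset.mul_sum, ← Equiv.sum_comp (Equiv.subRight u.1) F]
    simp
  simp only [h, Finset.sum_const, Finset.card_univ, Fintype.card_prod, Fintype.card_bool,
    Fintype.card_fin, nsmul_eq_mul]
  push_cast
  ring

theorem abs_sum_sum_sub_le (f : Vertex n → Vertex n → ℝ) (F : Fin (4 * n) → ℝ) (C : ℝ)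
    (h : ∀ u v, |f u v - F (v.1 - u.1)| ≤ C) :
    |(∑ u, ∑ v, f u v) / 2 - 8 * n * ∑ c, F c| ≤ 32 * C * n ^ 2 := by
  have h1 : (∑ u, ∑ v, f u v) / 2 - 8 * n * ∑ c, F c
      = (∑ u : Vertex n, ∑ v : Vertex n, (f u v - F (v.1 - u.1))) / 2 := by
    simp only [Finset.sum_sub_distrib]
    rw [sum_sum_column]
    ring
  have h2 : |∑ u : Vertex n, ∑ v : Vertex n, (f u v - F (v.1 - u.1))|
      ≤ ∑ u : Vertex n, ∑ v : Vertex n, C :=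
    (Finset.abs_sum_le_sum_abs _ _).trans <| Finset.sum_le_sum fun u _ =>
      (Finset.abs_sum_le_sum_abs _ _).trans <| Finset.sum_le_sum fun v _ => h u v
  simp only [Finset.sum_const, Finset.card_univ, Fintype.card_prod, Fintype.card_bool,
    Fintype.card_fin, nsmul_eq_mul] at h2
  push_cast at h2
  rw [h1, abs_div, abs_two, div_le_iff₀ two_pos]
  linarith

theorem sum_cyclePot :
    ∑ c : Fin (4 * n), cyclePot c / (4 * n) = (16 * n ^ 2 - 1) / 12 := by
  have hn : (n : ℝ) ≠ 0 := NeZero.ne _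
  -- `N` is kept separate from the range length so that induction on `m` applies.
  have h : ∀ (m : ℕ) (N : ℝ), ∑ k ∈ Finset.range m, (k : ℝ) * (N - k) / 2
      = N * m * (m - 1) / 4 - m * (m - 1) * (2 * m - 1) / 12 := by
    intro m N
    induction m with
    | zero => simp
    | succ m ih =>
      rw [Finset.sum_range_succ, ih]
      push_cast
      ring
  rw [← Finset.sum_div]
  unfold cyclePot
  rw [Fin.sum_univ_eq_sum_range fun k => (k : ℝ) * (4 * n - k) / 2, h]
  push_cast
  field_simp
  ring

namespace IsClosedStrip

variable {ε : Bool} {G : SimpleGraph (Vertex n)}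

theorem abs_wiener_sub_le (hG : IsClosedStrip ε G) :
    |wiener G - 32 * (n : ℝ) ^ 3| ≤ 96 * (n : ℝ) ^ 2 := by
  have h := abs_sum_sum_sub_le (fun u v => (G.dist u v : ℝ)) (fun c => (cycleDist c : ℝ)) 3
    fun u v => by
      have h1 : (cycleDist (v.1 - u.1) : ℝ) ≤ G.dist u v := by
        exact_mod_cast hG.cycleDist_le_dist u v
      have h2 : (G.dist u v : ℝ) ≤ cycleDist (v.1 - u.1) + 3 := by
        exact_mod_cast hG.dist_le_cycleDist u v
      rw [abs_le]
      constructor <;> linarith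
  rw [sum_cycleDist] at h
  rw [wiener]
  convert h using 1
  · congr 1
    ring
  · ring

theorem abs_kirchhoff_sub_le (hG : IsClosedStrip ε G) :
    |kirchhoff G - 32 / 3 * (n : ℝ) ^ 3| ≤ 289 * (n : ℝ) ^ 2 := by
  have h := abs_sum_sum_sub_le (resistance G) (fun c => cyclePot c / (4 * n)) 9
    hG.abs_resistance_sub_le
  rw [sum_cyclePot] at h
  have hn : (1 : ℝ) ≤ n := by exact_mod_cast one_le_of_neZero (n := n)
  rw [abs_le] at h ⊢
  rw [kirchhoff]
  -- The main term is `32/3 * n³ - 2/3 * n`; the linear term raises 288 = 32 * 9 to 289.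
  constructor <;> nlinarith [h.1, h.2]

end IsClosedStrip

end Strip

/-! ### Passage to the limit. -/

section Limits

theorem tendsto_div_cube {f : ℕ → ℝ} {a C : ℝ}
    (h : ∀ n : ℕ, 1 ≤ n → |f n - a * n ^ 3| ≤ C * n ^ 2) :
    Tendsto (fun n : ℕ => f n / (n : ℝ) ^ 3) atTop (𝓝 a) := by
  rw [tendsto_iff_norm_sub_tendsto_zero]
  refine squeeze_zero' (Eventually.of_forall fun n => norm_nonneg _) ?_
    (tendsto_const_div_atTop_nhds_zero_nat C)
  filter_upwards [eventually_ge_atTop 1] with n hn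
  have hn0 : (0 : ℝ) < n := by exact_mod_cast hn
  have h1 : f n / (n : ℝ) ^ 3 - a = (f n - a * n ^ 3) / n ^ 3 := by
    field_simp
  rw [Real.norm_eq_abs, h1, abs_div, abs_of_pos (pow_pos hn0 3), div_le_div_iff₀ (by positivity)
    hn0]
  have := mul_le_mul_of_nonneg_right (h n hn) hn0.le
  linarith

theorem tendsto_ratio_and_isEquivalent {W K : ℕ → ℝ} {C D : ℝ}
    (hW : ∀ n : ℕ, 1 ≤ n → |W n - 32 * n ^ 3| ≤ C * n ^ 2)
    (hK : ∀ n : ℕ, 1 ≤ n → |K n - 32 / 3 * n ^ 3| ≤ D * n ^ 2) :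
    Tendsto (fun n => W n / K n) atTop (𝓝 3) ∧ K ~[atTop] fun n => (1 / 3 : ℝ) * W n := by
  have hW' := tendsto_div_cube hW
  have hK' := tendsto_div_cube hK
  have hcancel : ∀ f g : ℕ → ℝ, (fun n : ℕ => f n / (n : ℝ) ^ 3 / (g n / (n : ℝ) ^ 3))
      =ᶠ[atTop] fun n => f n / g n := by
    intro f g
    filter_upwards [eventually_ge_atTop 1] with n hn
    exact div_div_div_cancel_right₀ (pow_ne_zero 3 (Nat.cast_ne_zero.2 (by omega))) _ _
  constructor
  · have h := (hW'.div hK' (by norm_num)).congr' (hcancel W K)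
    convert h using 2
    norm_num
  · refine isEquivalent_of_tendsto_one ?_
    have h := ((hK'.div hW' (by norm_num)).congr' (hcancel K W)).mul_const 3
    convert h using 2
    · simp only [Pi.div_apply]
      rw [one_div, div_mul_eq_div_div, div_inv_eq_mul]
      ring
    · norm_num

end Limits

end OctQuad

theorem corollary4p3 :
    (Tendsto (fun n : ℕ => OctQuad.wiener (OctQuad.mobius n) / OctQuad.kirchhoff (OctQuad.mobius n))
        atTop (𝓝 3) ∧
      Tendsto
        (fun n : ℕ => OctQuad.wiener (OctQuad.cylinder n) / OctQuad.kirchhoff (OctQuad.cylinder n))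
        atTop (𝓝 3)) ∧
    ((fun n : ℕ => OctQuad.kirchhoff (OctQuad.mobius n)) ~[atTop]
        (fun n : ℕ => (1 / 3 : ℝ) * OctQuad.wiener (OctQuad.mobius n)) ∧
      (fun n : ℕ => OctQuad.kirchhoff (OctQuad.cylinder n)) ~[atTop]
        (fun n : ℕ => (1 / 3 : ℝ) * OctQuad.wiener (OctQuad.cylinder n))) := by
  have key : ∀ (ε : Bool) (G : ∀ n : ℕ, SimpleGraph (OctQuad.Vertex n)),
      (∀ (n : ℕ) [NeZero n], OctQuad.IsClosedStrip ε (G n)) →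
      Tendsto (fun n => OctQuad.wiener (G n) / OctQuad.kirchhoff (G n)) atTop (𝓝 3) ∧
        (fun n => OctQuad.kirchhoff (G n)) ~[atTop]
          fun n => (1 / 3 : ℝ) * OctQuad.wiener (G n) := by
    intro ε G hG
    refine OctQuad.tendsto_ratio_and_isEquivalent (C := 96) (D := 289) ?_ ?_
    · intro n hn
      have : NeZero n := ⟨by omega⟩
      exact (hG n).abs_wiener_sub_le
    · intro n hn
      have : NeZero n := ⟨by omega⟩
      exact (hG n).abs_kirchhoff_sub_le
  have hm := key true OctQuad.mobius fun n _ => OctQuad.isClosedStrip_mobius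
  have hc := key false OctQuad.cylinder fun n _ => OctQuad.isClosedStrip_cylinder
  exact ⟨⟨hm.1, hc.1⟩, hm.2, hc.2⟩
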